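/- Let $K$ be a commutative unital ring and let $A$ be an associative, not necessarily unital $K$-algebra. Write $[x,y]=xy-yx$; for subsets $X,Y\subseteq A$ let $[X,Y]$ and $XY$ denote the additive subgroups generated by $\{[x,y] : x\in X, y\in Y\}$ and $\{xy : x\in X, y\in Y\}$, respectively, and put $X^2=XX$. Let $\widetilde{A}=K\times A$ be the unitization of $A$, with coordinatewise addition and scalar multiplication and with product $(\lambda,x)(\mu,y)=(\lambda\mu,\mu x+\lambda y+xy)$; it contains $A$ as an ideal. For $L\subseteq A$ let $\widetilde{A}L\widetilde{A}$ be the additive subgroup generated by the elements $axd$ with $a,d\in\widetilde{A}$ and $x\in L$; it is a two-sided ideal of $A$. Consider the ideals \[ I := \widetilde{A}\big[[A,A],[A,A]^2\big]\widetilde{A} \quad\text{and}\quad J := \widetilde{A}[A,A]\widetilde{A}, \] that is, the ideals of $A$ generated by $\big[[A,A],[A,A]^2\big]$ and by $[A,A]$. (1) We have $I\subseteq [A,A]^2\subseteq J$, and the ring $J/I$ is nil, that is, each of its elements is nilpotent. (2) For all $a,d\in\widetilde{A}$ and $b,c\in A$ there exist $n,m\ge 1$ and $w_j,x_j,y_j,z_j\in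 A$ for $j=1,\ldots,n$ such that \[ \big(a[b,c]d\big)^m=\sum_{j=1}^n [w_j,x_j][y_j,z_j]. \] (3) If $A=\widetilde{A}[A,A]\widetilde{A}$, then for every $a\in A$ there exist $n,m\ge 1$ and $b_j,c_j,d_j,e_j\in A$ for $j=1,\ldots,n$ such that \[ a^m=\sum_{j=1}^n [b_j,c_j][d_j,e_j]. \] -/

import Mathlib

open scoped Pointwise

/-- The additive subgroup `[X, Y]` generated by the commutators `[x, y] = xy - yx`
with `x ∈ X`, `y ∈ Y`. -/
def commSpan {A : Type*} [NonUnitalRing A] (X Y : Set A) : AddSubgroup A :=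
  AddSubgroup.closure {z | ∃ x ∈ X, ∃ y ∈ Y, ⁅x, y⁆ = z}

/-- The additive subgroup `XY` generated by the products `xy` with `x ∈ X`, `y ∈ Y`. -/
def prodSpan {A : Type*} [NonUnitalRing A] (X Y : Set A) : AddSubgroup A :=
  AddSubgroup.closure (X * Y)

/-- `[A, A]`. -/
def commAA (A : Type*) [NonUnitalRing A] : AddSubgroup A :=
  commSpan Set.univ Set.univ

/-- `[A, A]²`. -/
def commAASq (A : Type*) [NonUnitalRing A] : AddSubgroup A :=
  prodSpan (commAA A) (commAA A)

section

variable (K : Type*) {A : Type*} [CommRing K] [NonUnitalRing A] [Module K A]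
  [IsScalarTower K A A] [SMulCommClass K A A]

/-- The additive subgroup `Ã L Ã` of the unitization `Ã = K × A`. -/
def sandwich (L : Set A) : AddSubgroup (Unitization K A) :=
  AddSubgroup.closure
    {z | ∃ a : Unitization K A, ∃ x ∈ L, ∃ d : Unitization K A, a * (x : Unitization K A) * d = z}

theorem mul_mem_sandwich {L : Set A} (r : Unitization K A) {z : Unitization K A}
    (hz : z ∈ sandwich K L) : r * z ∈ sandwich K L := by
  induction hz using AddSubgroup.closure_induction with
  | mem z hz =>
    obtain ⟨a, x, hx, d, rfl⟩ := hz
    exact AddSubgroup.subset_closure ⟨r * a, x, hx, d, by simp only [mul_assoc]⟩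
  | zero => rw [mul_zero]; exact zero_mem _
  | add y z _ _ hy hz => rw [mul_add]; exact add_mem hy hz
  | neg y _ hy => rw [mul_neg]; exact neg_mem hy

theorem sandwich_mul_mem {L : Set A} (r : Unitization K A) {z : Unitization K A}
    (hz : z ∈ sandwich K L) : z * r ∈ sandwich K L := by
  induction hz using AddSubgroup.closure_induction with
  | mem z hz =>
    obtain ⟨a, x, hx, d, rfl⟩ := hz
    exact AddSubgroup.subset_closure ⟨a, x, hx, d * r, by simp only [mul_assoc]⟩
  | zero => rw [zero_mul]; exact zero_mem _
  | add y z _ _ hy hz => rw [add_mul]; exact add_mem hy hz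
  | neg y _ hy => rw [neg_mul]; exact neg_mem hy

/-- `Ã L Ã`, which lies in the ideal `A` of `Ã`, as a two-sided ideal of `A`. -/
def sandwichIdeal (L : Set A) : TwoSidedIdeal A :=
  TwoSidedIdeal.mk' {x | (x : Unitization K A) ∈ sandwich K L}
    (by simp [zero_mem])
    (fun {x y} hx hy => by
      simpa only [Set.mem_ofPred_eq, Unitization.inr_add] using add_mem hx hy)
    (fun {x} hx => by
      simpa only [Set.mem_ofPred_eq, Unitization.inr_neg] using neg_mem hx)
    (fun {x y} hy => by
      simpa only [Set.mem_ofPred_eq, Unitization.inr_mul] using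
        mul_mem_sandwich K (x : Unitization K A) hy)
    (fun {x y} hx => by
      simpa only [Set.mem_ofPred_eq, Unitization.inr_mul] using
        sandwich_mul_mem K (y : Unitization K A) hx)

variable (A)

/-- The ideal `I = Ã [[A, A], [A, A]²] Ã`. -/
def idealI : TwoSidedIdeal A :=
  sandwichIdeal K (commSpan (commAA A : Set A) (commAASq A : Set A) : Set A)

/-- The commutator ideal `J = Ã [A, A] Ã`. -/
def idealJ : TwoSidedIdeal A :=
  sandwichIdeal K (commAA A : Set A)

end

/-- The power `x ^ m`, `m ≥ 1`, in a ring without a unit; the value at `m = 0` is a dummy. -/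
def nuPow {R : Type*} [NonUnitalRing R] (x : R) : ℕ → R
  | 0 => 0
  | 1 => x
  | n + 2 => nuPow x (n + 1) * x

/-- A ring is nil if each of its elements is nilpotent. -/
def IsNilRing (R : Type*) [NonUnitalRing R] : Prop :=
  ∀ x : R, ∃ m : ℕ, 1 ≤ m ∧ nuPow x m = 0

/-- The quotient ring `J / I` (for ideals `I ⊆ J`): the ideal `J`, regarded as a ring, modulo
the ideal of `J` consisting of the elements that lie in `I`. -/
abbrev QuotIdeal {A : Type*} [NonUnitalRing A] (J I : TwoSidedIdeal A) : Type _ :=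
  (I.comap (NonUnitalSubringClass.subtype J)).ringCon.Quotient

/-! Two facts are combined. First, `[A, A]²` is a Lie ideal, which lets one absorb multipliers from
`Ã` on both sides of `[[A, A], [A, A]²]`; hence `I ⊆ [A, A]²`. Second, modulo `I` commutators
commute with products of two commutators, and a prime ring with this property is commutative
(`lie_eq_zero_of_prime`). So every prime ideal of `Ã` above `I` contains all commutators, hence `J`.
An element with no power in `I` would be avoided by some prime above `I` (Zorn), so elements of `J`
are nilpotent modulo `I`. Together, each element of `J` has a power in `[A, A]²`, which gives (2)
and (3). -/

/-- The sums of products of two commutators, that is, the elements of the form `∑ [wⱼ, xⱼ][yⱼ, zⱼ]`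
with at least one summand. -/
def IsSumCommProd {A : Type*} [NonUnitalRing A] (s : A) : Prop :=
  ∃ n : ℕ, 1 ≤ n ∧ ∃ w x y z : Fin n → A, s = ∑ j, ⁅w j, x j⁆ * ⁅y j, z j⁆

/-! ### Sums of products of two commutators -/

section Products

variable {A : Type*} [NonUnitalRing A]

theorem Ring.neg_lie_eq (x y : A) : -⁅x, y⁆ = ⁅y, x⁆ := by
  simp only [Ring.lie_def, neg_sub]

theorem IsSumCommProd.of_mul (w x y z : A) : IsSumCommProd (⁅w, x⁆ * ⁅y, z⁆) :=
  ⟨1, le_rfl, fun _ => w, fun _ => x, fun _ => y, fun _ => z, by simp⟩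

theorem IsSumCommProd.zero : IsSumCommProd (0 : A) := by
  simpa [Ring.lie_def] using IsSumCommProd.of_mul (0 : A) 0 0 0

theorem IsSumCommProd.add {s t : A} (hs : IsSumCommProd s) (ht : IsSumCommProd t) :
    IsSumCommProd (s + t) := by
  obtain ⟨n, hn, w, x, y, z, rfl⟩ := hs
  obtain ⟨m, _, w', x', y', z', rfl⟩ := ht
  exact ⟨n + m, by omega, Fin.append w w', Fin.append x x', Fin.append y y', Fin.append z z',
    by simp [Fin.sum_univ_add]⟩

theorem IsSumCommProd.neg {s : A} (hs : IsSumCommProd s) : IsSumCommProd (-s) := by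
  obtain ⟨n, hn, w, x, y, z, rfl⟩ := hs
  -- The sign is absorbed by swapping the entries of the first commutator.
  refine ⟨n, hn, x, w, y, z, ?_⟩
  rw [← Finset.sum_neg_distrib]
  refine Finset.sum_congr rfl fun j _ => ?_
  rw [← neg_mul, Ring.neg_lie_eq]

theorem lie_mem_commAA (x y : A) : ⁅x, y⁆ ∈ commAA A :=
  AddSubgroup.subset_closure ⟨x, trivial, y, trivial, rfl⟩

theorem mul_mem_commAASq {x y : A} (hx : x ∈ commAA A) (hy : y ∈ commAA A) :
    x * y ∈ commAASq A :=
  AddSubgroup.subset_closure (Set.mul_mem_mul hx hy)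

theorem commAA_induction {p : A → Prop} (lie : ∀ x y : A, p ⁅x, y⁆) (zero : p 0)
    (add : ∀ x y, p x → p y → p (x + y)) (neg : ∀ x, p x → p (-x)) {x : A}
    (hx : x ∈ commAA A) : p x := by
  induction hx using AddSubgroup.closure_induction with
  | mem z hz => obtain ⟨x, _, y, _, rfl⟩ := hz; exact lie x y
  | zero => exact zero
  | add y z _ _ hy hz => exact add y z hy hz
  | neg y _ hy => exact neg y hy

theorem commAASq_induction {p : A → Prop}
    (mul : ∀ x ∈ commAA A, ∀ y ∈ commAA A, p (x * y)) (zero : p 0)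
    (add : ∀ x y, p x → p y → p (x + y)) (neg : ∀ x, p x → p (-x)) {x : A}
    (hx : x ∈ commAASq A) : p x := by
  induction hx using AddSubgroup.closure_induction with
  | mem z hz =>
    obtain ⟨x, hx, y, hy, rfl⟩ := Set.mem_mul.1 hz
    exact mul x hx y hy
  | zero => exact zero
  | add y z _ _ hy hz => exact add y z hy hz
  | neg y _ hy => exact neg y hy

theorem isSumCommProd_of_mem {s : A} (hs : s ∈ commAASq A) : IsSumCommProd s := by
  refine commAASq_induction (fun x hx y hy => ?_) .zero (fun _ _ => .add) (fun _ => .neg) hs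
  refine commAA_induction (p := fun x => IsSumCommProd (x * y)) (fun a b => ?_) ?_
    (fun a b ha hb => ?_) (fun a ha => ?_) hx
  · refine commAA_induction (p := fun y => IsSumCommProd (⁅a, b⁆ * y))
      (fun c d => .of_mul a b c d) ?_ (fun c d hc hd => ?_) (fun c hc => ?_) hy
    · rw [mul_zero]; exact .zero
    · rw [mul_add]; exact hc.add hd
    · rw [mul_neg]; exact hc.neg
  · rw [zero_mul]; exact .zero
  · rw [add_mul]; exact ha.add hb
  · rw [neg_mul]; exact ha.neg

/-- `[A, A]²` is a Lie ideal. -/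
theorem lie_mem_commAASq (a : A) {s : A} (hs : s ∈ commAASq A) : ⁅a, s⁆ ∈ commAASq A := by
  refine commAASq_induction (p := fun s => ⁅a, s⁆ ∈ commAASq A) (fun x hx y hy => ?_) ?_
    (fun x y hx hy => ?_) (fun x hx => ?_) hs
  · have : ⁅a, x * y⁆ = ⁅a, x⁆ * y + x * ⁅a, y⁆ := by
      simp only [Ring.lie_def, sub_mul, mul_sub, mul_assoc]; abel
    rw [this]
    exact add_mem (mul_mem_commAASq (lie_mem_commAA _ _) hy)
      (mul_mem_commAASq hx (lie_mem_commAA _ _))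
  · simp [Ring.lie_def]
  · have : ⁅a, x + y⁆ = ⁅a, x⁆ + ⁅a, y⁆ := by
      simp only [Ring.lie_def, mul_add, add_mul]; abel
    rw [this]; exact add_mem hx hy
  · have : ⁅a, -x⁆ = -⁅a, x⁆ := by
      simp only [Ring.lie_def, mul_neg, neg_mul]; abel
    rw [this]; exact neg_mem hx

end Products

/-! ### Commutators in the unitization -/

section Unitization

variable {K A : Type*} [CommRing K] [NonUnitalRing A] [Module K A]

theorem Unitization.mul_inr_eq_inr (a : Unitization K A) (x : A) :
    a * (x : Unitization K A) = ((a.fst • x + a.snd * x : A) : Unitization K A) := by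
  ext <;> simp

theorem Unitization.inr_mul_eq_inr (x : A) (a : Unitization K A) :
    (x : Unitization K A) * a = ((a.fst • x + x * a.snd : A) : Unitization K A) := by
  ext <;> simp

/-- Scalars are central, so passing to the unital ring `Ã` creates no new commutators. -/
theorem Unitization.lie_eq_inr (a b : Unitization K A) :
    ⁅a, b⁆ = ((⁅a.snd, b.snd⁆ : A) : Unitization K A) := by
  rw [Ring.lie_def, Ring.lie_def, sub_eq_iff_eq_add]
  ext
  · rw [Unitization.fst_add, Unitization.fst_inr, Unitization.fst_mul, Unitization.fst_mul, zero_add,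
      mul_comm]
  · simp only [Unitization.snd_add, Unitization.snd_mul, Unitization.snd_inr]; abel

end Unitization

/-! ### The inclusions `I ⊆ [A, A]² ⊆ J` -/

section Ideals

variable (K : Type*) {A : Type*} [CommRing K] [NonUnitalRing A] [Module K A]
  [IsScalarTower K A A] [SMulCommClass K A A]

theorem mem_sandwichIdeal {L : Set A} {x : A} :
    x ∈ sandwichIdeal K L ↔ (x : Unitization K A) ∈ sandwich K L :=
  TwoSidedIdeal.mem_mk' ..

theorem subset_sandwichIdeal {L : Set A} {x : A} (hx : x ∈ L) : x ∈ sandwichIdeal K L :=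
  (mem_sandwichIdeal K).2 (AddSubgroup.subset_closure ⟨1, x, hx, 1, by simp⟩)

variable {K}

/-- Left multiplication by the unitization maps `[[A, A], [A, A]²]` into `[A, A]²`. -/
theorem fst_smul_add_snd_mul_mem_commAASq (a : Unitization K A) {x : A}
    (hx : x ∈ commSpan (commAA A : Set A) (commAASq A : Set A)) :
    a.fst • x + a.snd * x ∈ commAASq A := by
  induction hx using AddSubgroup.closure_induction with
  | mem z hz =>
    obtain ⟨l, hl, m, hm, rfl⟩ := hz
    -- This is `a[l, m] = [al, m] - [a, m]l`; the first term is handled by the Lie ideal property.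
    have : a.fst • ⁅l, m⁆ + a.snd * ⁅l, m⁆ =
        ⁅a.fst • l + a.snd * l, m⁆ - ⁅a.snd, m⁆ * l := by
      simp only [Ring.lie_def, sub_mul, mul_sub, add_mul, mul_add, mul_assoc, smul_sub,
        smul_mul_assoc, mul_smul_comm]
      abel
    rw [this]
    refine sub_mem ?_ (mul_mem_commAASq (lie_mem_commAA _ _) hl)
    exact lie_mem_commAASq _ hm
  | zero => simp
  | add y z _ _ hy hz =>
    rw [smul_add, mul_add, add_add_add_comm]; exact add_mem hy hz
  | neg y _ hy => rw [smul_neg, mul_neg, ← neg_add]; exact neg_mem hy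

/-- Since `axd = (da)x - [d, ax]`, the two-sided case reduces to left multiplication and the Lie
ideal property. -/
theorem exists_mem_commAASq_of_mem_sandwich {z : Unitization K A}
    (hz : z ∈ sandwich K (commSpan (commAA A : Set A) (commAASq A : Set A) : Set A)) :
    ∃ s ∈ commAASq A, z = (s : Unitization K A) := by
  induction hz using AddSubgroup.closure_induction with
  | mem z hz =>
    obtain ⟨a, x, hx, d, rfl⟩ := hz
    have h₁ := fst_smul_add_snd_mul_mem_commAASq (d * a) hx
    have h₂ := lie_mem_commAASq d.snd (fst_smul_add_snd_mul_mem_commAASq a hx)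
    refine ⟨_, sub_mem h₁ h₂, ?_⟩
    rw [Unitization.inr_sub, ← Unitization.mul_inr_eq_inr]
    have : ((⁅d.snd, a.fst • x + a.snd * x⁆ : A) : Unitization K A)
        = ⁅d, a * (x : Unitization K A)⁆ := by
      rw [Unitization.mul_inr_eq_inr, Unitization.lie_eq_inr, Unitization.snd_inr]
    rw [this, Ring.lie_def]
    noncomm_ring
  | zero => exact ⟨0, zero_mem _, by simp⟩
  | add y z _ _ hy hz =>
    obtain ⟨s, hs, rfl⟩ := hy
    obtain ⟨t, ht, rfl⟩ := hz
    exact ⟨s + t, add_mem hs ht, by simp⟩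
  | neg y _ hy =>
    obtain ⟨s, hs, rfl⟩ := hy
    exact ⟨-s, neg_mem hs, by simp⟩

theorem mem_commAASq_of_mem_idealI {x : A} (hx : x ∈ idealI K A) : x ∈ commAASq A := by
  obtain ⟨s, hs, h⟩ := exists_mem_commAASq_of_mem_sandwich ((mem_sandwichIdeal K).1 hx)
  rwa [Unitization.inr_injective h]

theorem mem_idealJ_of_mem_commAASq {x : A} (hx : x ∈ commAASq A) : x ∈ idealJ K A :=
  commAASq_induction
    (fun x hx y _ => TwoSidedIdeal.mul_mem_right _ x y (subset_sandwichIdeal K hx))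
    (TwoSidedIdeal.zero_mem _) (fun _ _ => TwoSidedIdeal.add_mem _)
    (fun _ => TwoSidedIdeal.neg_mem _) hx

end Ideals

/-! ### Prime rings and prime ideals -/

section PrimeRing

variable {R : Type*} [Ring R]

/-- A prime ring in which commutators commute with products of two commutators is commutative. -/
theorem lie_eq_zero_of_prime
    (prime : ∀ a b : R, (∀ r, a * r * b = 0) → a = 0 ∨ b = 0)
    (h : ∀ a b c d e f : R, ⁅⁅a, b⁆, ⁅c, d⁆ * ⁅e, f⁆⁆ = 0) (a b : R) : ⁅a, b⁆ = 0 := by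
  -- Expanding `[m, [x, xb]] = 0` yields `[m, x][x, b] = 0`, hence `[m, x] R [x, y] = 0`; primeness
  -- with `y = m` gives `[m, x] = 0`.
  have central : ∀ c d e f x : R, ⁅⁅c, d⁆ * ⁅e, f⁆, x⁆ = 0 := by
    intro c d e f x
    generalize hm : ⁅c, d⁆ * ⁅e, f⁆ = m
    have hm' : ∀ a b : R, ⁅m, ⁅a, b⁆⁆ = 0 := fun a b => by
      rw [← Ring.neg_lie_eq, ← hm, h, neg_zero]
    have h₁ : ∀ b : R, ⁅m, x⁆ * ⁅x, b⁆ = 0 := fun b => by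
      have e₁ := hm' x (x * b)
      have e₂ := hm' x b
      have : ⁅m, ⁅x, x * b⁆⁆ = ⁅m, x⁆ * ⁅x, b⁆ + x * ⁅m, ⁅x, b⁆⁆ := by
        simp only [Ring.lie_def]; noncomm_ring
      rw [e₁, e₂, mul_zero, add_zero] at this
      exact this.symm
    have h₂ : ∀ y : R, ⁅m, x⁆ = 0 ∨ ⁅x, y⁆ = 0 := fun y => prime _ _ fun r => by
      have : ⁅m, x⁆ * r * ⁅x, y⁆ = ⁅m, x⁆ * ⁅x, r * y⁆ - ⁅m, x⁆ * ⁅x, r⁆ * y := by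
        simp only [Ring.lie_def]; noncomm_ring
      rw [this, h₁, h₁, zero_mul, sub_zero]
    rcases h₂ m with h₃ | h₃
    · exact h₃
    · rw [← Ring.neg_lie_eq, h₃, neg_zero]
  have zero_mul_zero : ∀ a b c d : R, ⁅a, b⁆ * ⁅c, d⁆ = 0 := by
    intro a b c d
    -- Both `[a, b][c, d]` and `a[a, b][c, d] = [a, ab][c, d]` are central.
    have key : ∀ y : R, ⁅a, y⁆ * (⁅a, b⁆ * ⁅c, d⁆) = 0 := fun y => by
      have e₁ := central a (a * b) c d y
      have e₂ := central a b c d y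
      have : ⁅⁅a, a * b⁆ * ⁅c, d⁆, y⁆ =
          ⁅a, y⁆ * (⁅a, b⁆ * ⁅c, d⁆) + a * ⁅⁅a, b⁆ * ⁅c, d⁆, y⁆ := by
        simp only [Ring.lie_def]; noncomm_ring
      rw [e₁, e₂, mul_zero, add_zero] at this
      exact this.symm
    rcases prime ⁅a, b⁆ (⁅a, b⁆ * ⁅c, d⁆) (fun r => by
      have comm : r * (⁅a, b⁆ * ⁅c, d⁆) = ⁅a, b⁆ * ⁅c, d⁆ * r := by
        have := central a b c d r
        rw [Ring.lie_def, sub_eq_zero] at this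
        exact this.symm
      rw [mul_assoc, comm, ← mul_assoc, key, zero_mul]) with h₀ | h₀
    · rw [h₀, zero_mul]
    · exact h₀
  rcases prime ⁅a, b⁆ ⁅a, b⁆ (fun r => by
    have : ⁅a, b⁆ * r * ⁅a, b⁆ = ⁅a, b⁆ * ⁅a, r * b⁆ - ⁅a, b⁆ * ⁅a, r⁆ * b := by
      simp only [Ring.lie_def]; noncomm_ring
    rw [this, zero_mul_zero, zero_mul_zero, zero_mul, sub_zero]) with h₀ | h₀ <;> exact h₀

/-- The elements `u` with `u R b ⊆ P`. -/
def TwoSidedIdeal.leftTransporter (P : TwoSidedIdeal R) (b : R) : TwoSidedIdeal R :=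
  TwoSidedIdeal.mk' {u | ∀ r, u * r * b ∈ P}
    (fun r => by simp [P.zero_mem])
    (fun {x y} hx hy r => by simpa only [add_mul] using P.add_mem (hx r) (hy r))
    (fun {x} hx r => by simpa only [neg_mul] using P.neg_mem (hx r))
    (fun {x y} hy r => by simpa only [mul_assoc] using P.mul_mem_left x _ (hy r))
    (fun {x y} hx r => by simpa only [mul_assoc] using hx (y * r))

/-- The elements `v` with `a R v ⊆ P`. -/
def TwoSidedIdeal.rightTransporter (P : TwoSidedIdeal R) (a : R) : TwoSidedIdeal R :=
  TwoSidedIdeal.mk' {v | ∀ r, a * r * v ∈ P}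
    (fun r => by simp [P.zero_mem])
    (fun {x y} hx hy r => by simpa only [mul_add] using P.add_mem (hx r) (hy r))
    (fun {x} hx r => by simpa only [mul_neg] using P.neg_mem (hx r))
    (fun {x y} hy r => by simpa only [mul_assoc] using hy (r * x))
    (fun {x y} hx r => by simpa only [mul_assoc] using P.mul_mem_right _ y (hx r))

theorem TwoSidedIdeal.mem_leftTransporter {P : TwoSidedIdeal R} {b u : R} :
    u ∈ P.leftTransporter b ↔ ∀ r, u * r * b ∈ P :=
  TwoSidedIdeal.mem_mk' ..

theorem TwoSidedIdeal.mem_rightTransporter {P : TwoSidedIdeal R} {a v : R} :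
    v ∈ P.rightTransporter a ↔ ∀ r, a * r * v ∈ P :=
  TwoSidedIdeal.mem_mk' ..

/-- The union of a nonempty chain of two-sided ideals. -/
def TwoSidedIdeal.chainUnion (c : Set (TwoSidedIdeal R)) (hc : IsChain (· ≤ ·) c)
    (hne : c.Nonempty) : TwoSidedIdeal R :=
  TwoSidedIdeal.mk' {x | ∃ P ∈ c, x ∈ P}
    (hne.imp fun P hP => ⟨hP, P.zero_mem⟩)
    (by
      rintro x y ⟨P, hP, hx⟩ ⟨Q, hQ, hy⟩
      rcases hc.total hP hQ with h | h
      · exact ⟨Q, hQ, Q.add_mem (h hx) hy⟩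
      · exact ⟨P, hP, P.add_mem hx (h hy)⟩)
    (by rintro x ⟨P, hP, hx⟩; exact ⟨P, hP, P.neg_mem hx⟩)
    (by rintro x y ⟨P, hP, hy⟩; exact ⟨P, hP, P.mul_mem_left x y hy⟩)
    (by rintro x y ⟨P, hP, hx⟩; exact ⟨P, hP, P.mul_mem_right x y hx⟩)

theorem TwoSidedIdeal.mem_chainUnion {c : Set (TwoSidedIdeal R)} {hc : IsChain (· ≤ ·) c}
    {hne : c.Nonempty} {x : R} : x ∈ chainUnion c hc hne ↔ ∃ P ∈ c, x ∈ P :=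
  TwoSidedIdeal.mem_mk' ..

/-- If no power of `x` lies in `I`, then some prime ideal above `I` contains no power of `x`. -/
theorem TwoSidedIdeal.exists_prime_ge_forall_pow_notMem (I : TwoSidedIdeal R) (x : R)
    (hx : ∀ n, x ^ n ∉ I) :
    ∃ P : TwoSidedIdeal R, I ≤ P ∧ (∀ n, x ^ n ∉ P) ∧
      ∀ a b : R, (∀ r, a * r * b ∈ P) → a ∈ P ∨ b ∈ P := by
  obtain ⟨P, hIP, hP⟩ := zorn_le_nonempty₀ {P : TwoSidedIdeal R | ∀ n, x ^ n ∉ P}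
    (fun c hcs hc P hP => ⟨chainUnion c hc ⟨P, hP⟩, fun n hn => by
      obtain ⟨Q, hQ, h⟩ := mem_chainUnion.1 hn
      exact hcs hQ n h, fun Q hQ y hy => mem_chainUnion.2 ⟨Q, hQ, hy⟩⟩) I hx
  have max : ∀ Q : TwoSidedIdeal R, P ≤ Q → ∀ b ∈ Q, b ∉ P → ∃ n, x ^ n ∈ Q := by
    intro Q hPQ b hb hbP
    by_contra! hQ
    exact hbP (hP.2 hQ hPQ hb)
  refine ⟨P, hIP, hP.1, fun a b hab => ?_⟩
  by_contra! hne
  -- This transporter contains `P` and `a ∉ P`, so by maximality some `x ^ n` satisfies `x ^ n R b ⊆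
  -- P`. The same argument on the right then trades `b` for some `x ^ m`.
  obtain ⟨n, hn⟩ := max (P.leftTransporter b)
    (fun u hu => mem_leftTransporter.2 fun r => P.mul_mem_right _ _ (P.mul_mem_right _ _ hu))
    a (mem_leftTransporter.2 hab) hne.1
  obtain ⟨m, hm⟩ := max (P.rightTransporter (x ^ n))
    (fun u hu => mem_rightTransporter.2 fun r => P.mul_mem_left _ _ hu)
    b (mem_rightTransporter.2 (mem_leftTransporter.1 hn)) hne.2
  refine hP.1 (n + m) ?_
  rw [pow_add]
  simpa using mem_rightTransporter.1 hm 1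

/-- If commutators commute with products of two commutators modulo `I`, then every element that
lies in all ideals containing the commutators is nilpotent modulo `I`. -/
theorem TwoSidedIdeal.exists_pow_mem_of_lie_identity (I : TwoSidedIdeal R)
    (h : ∀ a b c d e f : R, ⁅⁅a, b⁆, ⁅c, d⁆ * ⁅e, f⁆⁆ ∈ I) (x : R)
    (hx : ∀ P : TwoSidedIdeal R, (∀ a b : R, ⁅a, b⁆ ∈ P) → x ∈ P) : ∃ n, x ^ n ∈ I := by
  by_contra! hpow
  obtain ⟨P, hIP, hP, prime⟩ := I.exists_prime_ge_forall_pow_notMem x hpow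
  refine hP 1 ?_
  rw [pow_one]
  refine hx P fun a b => ?_
  have hmk : ∀ y : R, P.ringCon.mk' y = 0 ↔ y ∈ P := fun y => by
    rw [← TwoSidedIdeal.mem_ker, TwoSidedIdeal.ker_ringCon_mk']
  have lie : ∀ a b : R, P.ringCon.mk' ⁅a, b⁆ = ⁅P.ringCon.mk' a, P.ringCon.mk' b⁆ := fun a b => by
    simp only [Ring.lie_def, map_sub, map_mul]
  rw [← hmk, lie]
  have surj := RingCon.mk'_surjective P.ringCon
  refine lie_eq_zero_of_prime (fun a b => ?_) (fun a b c d e f => ?_) _ _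
  · obtain ⟨a, rfl⟩ := surj a
    obtain ⟨b, rfl⟩ := surj b
    intro hab
    rw [hmk, hmk]
    refine prime a b fun r => ?_
    rw [← hmk, map_mul, map_mul, hab]
  · obtain ⟨a, rfl⟩ := surj a
    obtain ⟨b, rfl⟩ := surj b
    obtain ⟨c, rfl⟩ := surj c
    obtain ⟨d, rfl⟩ := surj d
    obtain ⟨e, rfl⟩ := surj e
    obtain ⟨f, rfl⟩ := surj f
    rw [← lie, ← lie, ← lie, ← map_mul, ← lie, hmk]
    exact hIP (h a b c d e f)

end PrimeRing

/-! ### Nilpotency of `J / I` -/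

section Nil

variable {R S : Type*} [NonUnitalRing R] [NonUnitalRing S]

theorem map_nuPow {F : Type*} [FunLike F R S] [NonUnitalRingHomClass F R S] (f : F) (x : R) :
    ∀ n, f (nuPow x n) = nuPow (f x) n
  | 0 => map_zero f
  | 1 => rfl
  | n + 2 => by rw [nuPow, map_mul, map_nuPow f x (n + 1), nuPow]

theorem RingCon.coe_nuPow (c : RingCon R) (x : R) :
    ∀ n, ((nuPow x n : R) : c.Quotient) = nuPow (x : c.Quotient) n
  | 0 => rfl
  | 1 => rfl
  | n + 2 => by rw [nuPow, RingCon.coe_mul, RingCon.coe_nuPow c x (n + 1), nuPow]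

theorem nuPow_eq_pow {R : Type*} [Ring R] (x : R) : ∀ n, nuPow x (n + 1) = x ^ (n + 1)
  | 0 => (pow_one x).symm
  | n + 1 => by rw [nuPow, nuPow_eq_pow x n, ← pow_succ]

variable {K A : Type*} [CommRing K] [NonUnitalRing A] [Module K A]
  [IsScalarTower K A A] [SMulCommClass K A A]

theorem Unitization.inr_nuPow (x : A) (n : ℕ) :
    ((nuPow x (n + 1) : A) : Unitization K A) = (x : Unitization K A) ^ (n + 1) := by
  rw [← nuPow_eq_pow]
  exact map_nuPow (Unitization.inrNonUnitalAlgHom K A) x (n + 1)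

variable (K) in
/-- `Ã L Ã` as a two-sided ideal of the unitization. -/
def sandwichTwoSided (L : Set A) : TwoSidedIdeal (Unitization K A) :=
  TwoSidedIdeal.mk' (sandwich K L) (zero_mem _) add_mem neg_mem
    (mul_mem_sandwich K _) (sandwich_mul_mem K _)

theorem mem_sandwichTwoSided {L : Set A} {z : Unitization K A} :
    z ∈ sandwichTwoSided K L ↔ z ∈ sandwich K L :=
  TwoSidedIdeal.mem_mk' ..

/-- Every element of the commutator ideal `J` is nilpotent modulo `I`. -/
theorem exists_nuPow_mem_idealI {x : A} (hx : x ∈ idealJ K A) :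
    ∃ m, 1 ≤ m ∧ nuPow x m ∈ idealI K A := by
  obtain ⟨n, hn⟩ := TwoSidedIdeal.exists_pow_mem_of_lie_identity
    (sandwichTwoSided K (commSpan (commAA A : Set A) (commAASq A : Set A) : Set A))
    (fun a b c d e f => by
      rw [mem_sandwichTwoSided]
      simp only [Unitization.lie_eq_inr, ← Unitization.inr_mul, Unitization.snd_inr]
      exact (mem_sandwichIdeal K).1 (subset_sandwichIdeal K (AddSubgroup.subset_closure
        ⟨_, lie_mem_commAA _ _, _,
          mul_mem_commAASq (lie_mem_commAA _ _) (lie_mem_commAA _ _), rfl⟩)))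
    (x : Unitization K A) (fun P hP => by
      have hmem := (mem_sandwichIdeal K).1 hx
      generalize (x : Unitization K A) = t at hmem
      induction hmem using AddSubgroup.closure_induction with
      | mem z hz =>
        obtain ⟨a, y, hy, d, rfl⟩ := hz
        refine P.mul_mem_right _ _ (P.mul_mem_left _ _ ?_)
        refine commAA_induction (p := fun y : A => (y : Unitization K A) ∈ P) (fun u v => ?_) ?_
          (fun u v hu hv => ?_) (fun u hu => ?_) hy
        · simpa [Unitization.lie_eq_inr] using hP (u : Unitization K A) (v : Unitization K A)
        · simp [P.zero_mem]
        · simpa using P.add_mem hu hv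
        · simpa using P.neg_mem hu
      | zero => exact P.zero_mem
      | add y z _ _ hy hz => exact P.add_mem hy hz
      | neg y _ hy => exact P.neg_mem hy)
  -- The exponent `n` may be `0`, so one more factor `x` makes it positive.
  refine ⟨n + 1, by omega, (mem_sandwichIdeal K).2 ?_⟩
  rw [Unitization.inr_nuPow, pow_succ]
  exact mem_sandwichTwoSided.1 (TwoSidedIdeal.mul_mem_right _ _ _ hn)

theorem isNilRing_quotIdeal : IsNilRing (QuotIdeal (idealJ K A) (idealI K A)) := by
  intro q
  induction q using Quotient.inductionOn with
  | h j =>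
    obtain ⟨m, hm, h⟩ := exists_nuPow_mem_idealI j.2
    refine ⟨m, hm, ?_⟩
    rw [show (Quotient.mk _ j : QuotIdeal (idealJ K A) (idealI K A)) =
      ((j : idealJ K A) : QuotIdeal (idealJ K A) (idealI K A)) from rfl, ← RingCon.coe_nuPow]
    refine ((RingCon.eq _).2 ?_ : _ = ((0 : idealJ K A) : QuotIdeal (idealJ K A) (idealI K A)))
    rw [← TwoSidedIdeal.mem_iff, TwoSidedIdeal.mem_comap, map_nuPow]
    exact h

end Nil

theorem mainTheorem2 (K : Type*) (A : Type*) [CommRing K] [NonUnitalRing A] [Module K A]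
    [IsScalarTower K A A] [SMulCommClass K A A] :
    ((idealI K A : Set A) ⊆ (commAASq A : Set A) ∧
      (commAASq A : Set A) ⊆ (idealJ K A : Set A) ∧
      IsNilRing (QuotIdeal (idealJ K A) (idealI K A))) ∧
    (∀ (a d : Unitization K A) (b c : A),
      ∃ n m : ℕ, 1 ≤ n ∧ 1 ≤ m ∧ ∃ w x y z : Fin n → A,
        (a * ((⁅b, c⁆ : A) : Unitization K A) * d) ^ m =
          ((∑ j, ⁅w j, x j⁆ * ⁅y j, z j⁆ : A) : Unitization K A)) ∧
    ((idealJ K A : Set A) = Set.univ →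
      ∀ a : A, ∃ n m : ℕ, 1 ≤ n ∧ 1 ≤ m ∧ ∃ b c d e : Fin n → A,
        nuPow a m = ∑ j, ⁅b j, c j⁆ * ⁅d j, e j⁆) := by
  have key : ∀ x ∈ idealJ K A, ∃ m, 1 ≤ m ∧ IsSumCommProd (nuPow x m) := fun x hx => by
    obtain ⟨m, hm, h⟩ := exists_nuPow_mem_idealI hx
    exact ⟨m, hm, isSumCommProd_of_mem (mem_commAASq_of_mem_idealI h)⟩
  refine ⟨⟨fun x hx => mem_commAASq_of_mem_idealI hx,
    fun x hx => mem_idealJ_of_mem_commAASq hx, isNilRing_quotIdeal⟩, fun a d b c => ?_,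
    fun hJ a => ?_⟩
  · obtain ⟨t, ht⟩ : ∃ t : A, a * ((⁅b, c⁆ : A) : Unitization K A) * d = t :=
      ⟨_, by rw [Unitization.mul_inr_eq_inr, Unitization.inr_mul_eq_inr]⟩
    obtain ⟨m, hm, n, hn, w, x, y, z, h⟩ := key t <| (mem_sandwichIdeal K).2 <|
      AddSubgroup.subset_closure ⟨a, ⁅b, c⁆, lie_mem_commAA b c, d, ht⟩
    obtain ⟨k, rfl⟩ := Nat.exists_eq_add_of_le' hm
    exact ⟨n, k + 1, hn, hm, w, x, y, z, by rw [ht, ← Unitization.inr_nuPow, h]⟩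
  · obtain ⟨m, hm, n, hn, w, x, y, z, h⟩ :=
      key a (hJ.symm ▸ Set.mem_univ a : a ∈ (idealJ K A : Set A))
    exact ⟨n, m, hn, hm, w, x, y, z, h⟩
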